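/- A sequence $(a_n)_{n\in\omega}$ in a group $G$ is called a $T$-sequence if it converges to zero (the neutral element) in some non-discrete Hausdorff group topology on $G$. A group topology $\tau$ on $G$ is determined by a $T$-sequence if there is a $T$-sequence $(a_n)_{n\in\omega}$ in $G$ such that $\tau$ is the strongest group topology on $G$ in which $(a_n)$ converges to zero. For two group topologies $\tau_1,\tau_2$ on $G$, $\tau_1\vee\tau_2$ denotes the weakest topology $\tau$ on $G$ such that the identity maps $(G,\tau)\to(G,\tau_i)$, $i=1,2$, are continuous. A Hausdorff topological group $G$ is a $k_\omega$-group if it admits a countable cover $\mathcal K$ by compact subspaces such that a subset $U\subset G$ is open in $G$ if and only if $U\cap K$ is open in $K$ for every $K\in\mathcal K$. Corollary 1. There exist a countable Abelian group $G$ and two group topologies $\tau_1,\tau_2$ on $G$, each determined by a $T$-sequence, such that $(G,\tau_1\vee\tau_2)$ is a $k_\omega$-group which is not determined by a $T$-sequence. -/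

import Mathlib

open Filter Topology

/-- The sequence `a` converges to zero in the group topology `τ` on `G`. -/
def ConvergesToZero {G : Type*} [AddGroup G] (τ : AddGroupTopology G) (a : ℕ → G) : Prop :=
  Tendsto a atTop (@nhds G τ.toTopologicalSpace 0)

/-- `a` is a `T`-sequence in `G`: it converges to zero in some non-discrete Hausdorff
group topology on `G`. -/
def IsTSequence {G : Type*} [AddGroup G] (a : ℕ → G) : Prop :=
  ∃ τ : AddGroupTopology G,
    @T2Space G τ.toTopologicalSpace ∧ ¬ @DiscreteTopology G τ.toTopologicalSpace ∧
      ConvergesToZero τ a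

/-- `τ` is the strongest group topology on `G` in which the sequence `a` converges to zero.
In Mathlib's order on group topologies, `τ ≤ σ` says that every `σ`-open set is `τ`-open,
i.e. that `τ` is stronger (finer) than `σ`. -/
def IsStrongestTopologyFor {G : Type*} [AddGroup G] (τ : AddGroupTopology G) (a : ℕ → G) : Prop :=
  ConvergesToZero τ a ∧ ∀ σ : AddGroupTopology G, ConvergesToZero σ a → τ ≤ σ

/-- The topological group `(G, τ)` is determined by a `T`-sequence. -/
def IsDeterminedByTSequence {G : Type*} [AddGroup G] (τ : AddGroupTopology G) : Prop :=
  ∃ a : ℕ → G, IsTSequence a ∧ IsStrongestTopologyFor τ a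

/-- The supremum `τ₁ ∨ τ₂`: the weakest topology for which both identity maps onto `(G, τ₁)` and
`(G, τ₂)` are continuous. As Mathlib orders topologies by reverse inclusion of their open sets,
it is an infimum there. -/
def joinTopology {G : Type*} [AddGroup G] (τ₁ τ₂ : AddGroupTopology G) : AddGroupTopology G :=
  τ₁ ⊓ τ₂

/-- The topological group `(G, τ)` is a `k_ω`-group: it is Hausdorff and has a countable cover `𝒦`
by compact subsets such that `U` is open in `G` if and only if `U ∩ K` is open in `K` for every
`K ∈ 𝒦`. -/
def IsKOmegaGroup {G : Type*} [AddGroup G] (τ : AddGroupTopology G) : Prop :=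
  letI : TopologicalSpace G := τ.toTopologicalSpace
  T2Space G ∧ ∃ 𝒦 : Set (Set G), 𝒦.Countable ∧ (∀ K ∈ 𝒦, IsCompact K) ∧ ⋃₀ 𝒦 = Set.univ ∧
    ∀ U : Set G, IsOpen U ↔ ∀ K ∈ 𝒦, IsOpen ((↑) ⁻¹' U : Set K)

/-
In the Boolean group whose basis is arranged in blocks `(m, n)` of `m + 1` elements, let `τ₁` and
`τ₂` be the strongest group topologies in which the basis elements, respectively the sums of the
blocks, converge to zero. The span of the block sums is open in `τ₂`. If one of its elements is a
sum of basis elements in which the `i`-th term is `τ₁`-small, then among the `m + 1` terms in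
a block of row `m` there is one whose number is at least `m`. So a neighbourhood of zero in
`τ₁ ∨ τ₂` consists of the sums whose `i`-th term comes from a tail of the rows `0, …, i` of the
block sums, and this is the `k_ω`-topology defined by these rows, each of which converges to zero.

A sequence converging to zero in `τ₁ ∨ τ₂` is eventually supported in finitely many rows of blocks.
If it determined `τ₁ ∨ τ₂`, the subgroup of all elements supported in these rows would be open;
but the block sums in the next row converge to zero and lie outside it.
-/

open Set
open scoped Pointwise

section GroupTopology

variable {G : Type*}

/-- The filter of neighbourhoods of zero in the group topology `τ`. -/
abbrev nhdsZero [AddGroup G] (τ : AddGroupTopology G) : Filter G :=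
  @nhds G τ.toTopologicalSpace 0

theorem nhdsZero_joinTopology [AddGroup G] (τ₁ τ₂ : AddGroupTopology G) :
    nhdsZero (joinTopology τ₁ τ₂) = nhdsZero τ₁ ⊓ nhdsZero τ₂ :=
  nhds_inf

/-- The strongest group topology in which the filter `F` converges to zero. A filter instead of a
sequence allows families with other index sets, and makes reindexing an equality of filters. -/
def strongestTopology [AddGroup G] (F : Filter G) : AddGroupTopology G :=
  sInf {τ | F ≤ nhdsZero τ}

theorem le_nhdsZero_strongestTopology [AddGroup G] (F : Filter G) :
    F ≤ nhdsZero (strongestTopology F) := by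
  rw [nhdsZero, strongestTopology, AddGroupTopology.toTopologicalSpace_sInf, nhds_sInf]
  refine le_iInf₂ ?_
  rintro _ ⟨τ, hτ, rfl⟩
  exact hτ

theorem strongestTopology_le [AddGroup G] {F : Filter G} {τ : AddGroupTopology G}
    (h : F ≤ nhdsZero τ) : strongestTopology F ≤ τ :=
  sInf_le h

theorem isStrongestTopologyFor_iff [AddGroup G] {τ : AddGroupTopology G} {a : ℕ → G} :
    IsStrongestTopologyFor τ a ↔ τ = strongestTopology (map a atTop) := by
  constructor
  · rintro ⟨ha, hτ⟩
    exact le_antisymm (hτ _ (le_nhdsZero_strongestTopology _)) (strongestTopology_le ha)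
  · rintro rfl
    exact ⟨le_nhdsZero_strongestTopology _, fun _ => strongestTopology_le⟩

theorem isDeterminedByTSequence_strongestTopology [AddGroup G] {ι : Type*} [Countable ι]
    [Infinite ι] {a : ι → G}
    (hT2 : @T2Space G (strongestTopology (map a cofinite)).toTopologicalSpace)
    (ha : ∃ᶠ i in cofinite, a i ≠ 0) :
    IsDeterminedByTSequence (strongestTopology (map a cofinite)) := by
  obtain ⟨_⟩ := nonempty_denumerable ι
  let e : ℕ ≃ ι := (Denumerable.eqv ι).symm
  have he : map (a ∘ e) atTop = map a cofinite := by
    rw [← map_map, ← Nat.cofinite_eq_atTop, ← e.injective.comap_cofinite_eq,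
      map_comap_of_surjective e.surjective]
  have hlim := le_nhdsZero_strongestTopology (map a cofinite)
  refine ⟨a ∘ e, ⟨_, hT2, fun _ => ha ?_, he.trans_le hlim⟩,
    isStrongestTopologyFor_iff.2 (by rw [he])⟩
  let := (strongestTopology (map a cofinite)).toTopologicalSpace
  filter_upwards [hlim ((isOpen_discrete {0}).mem_nhds rfl)] with i hi
  exact not_not_intro hi

end GroupTopology

section FiniteSums

variable {G : Type*}

section AddCommMonoid

variable [AddCommMonoid G]

/-- The sums of finitely many terms taken from different members of the sequence `E` of sets. -/
def finiteSums (E : ℕ → Set G) : Set G :=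
  ⋃ I : Finset ℕ, ∑ i ∈ I, E i

theorem mem_finiteSums {E : ℕ → Set G} {x : G} :
    x ∈ finiteSums E ↔ ∃ (I : Finset ℕ) (z : ℕ → G), (∀ i ∈ I, z i ∈ E i) ∧ ∑ i ∈ I, z i = x := by
  simp only [finiteSums, mem_iUnion, mem_finsetSum, exists_prop]

theorem sum_mem_finiteSums {ι : Type*} {E : ℕ → Set G} {S : Finset ι} {ψ : ι → ℕ} {a : ι → G}
    (hψ : InjOn ψ S) (ha : ∀ s ∈ S, a s ∈ E (ψ s)) : ∑ s ∈ S, a s ∈ finiteSums E := by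
  refine mem_iUnion.2 ⟨S.image ψ, ?_⟩
  rw [Finset.sum_image hψ]
  exact finsetSum_mem_finsetSum _ _ _ ha

theorem finiteSums_mono {E E' : ℕ → Set G} (h : ∀ i, E i ⊆ E' i) :
    finiteSums E ⊆ finiteSums E' :=
  iUnion_mono fun I => finsetSum_subset_finsetSum I _ _ fun i _ => h i

theorem finiteSums_subset_addSubmonoid {E : ℕ → Set G} {H : AddSubmonoid G} (h : ∀ i, E i ⊆ H) :
    finiteSums E ⊆ H := by
  intro x hx
  obtain ⟨I, z, hz, rfl⟩ := mem_finiteSums.1 hx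
  exact H.sum_mem fun i hi => h i (hz i hi)

theorem finiteSums_add_finiteSums_subset (E : ℕ → Set G) :
    finiteSums (fun i => E (2 * i)) + finiteSums (fun i => E (2 * i + 1)) ⊆ finiteSums E := by
  refine add_subset_iff.2 fun x hx y hy => ?_
  obtain ⟨I, z, hz, rfl⟩ := mem_finiteSums.1 hx
  obtain ⟨J, w, hw, rfl⟩ := mem_finiteSums.1 hy
  suffices ∑ s ∈ I.disjSum J, Sum.elim z w s ∈ finiteSums E by simpa [Finset.sum_disjSum] using this
  refine sum_mem_finiteSums (ψ := Sum.elim (2 * ·) (2 * · + 1)) ?_ ?_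
  · rintro (i | i) - (j | j) - hij <;> simp at hij ⊢ <;> omega
  · rintro (i | j) hs
    exacts [hz i (Finset.inl_mem_disjSum.1 hs), hw j (Finset.inr_mem_disjSum.1 hs)]

end AddCommMonoid

variable [AddCommGroup G]

/-- The sums of sequences of symmetric members of `F`, as a base of neighbourhoods of zero for
a group topology. -/
@[reducible]
def finiteSumsFilterBasis (F : Filter G) : AddGroupFilterBasis G :=
  addGroupFilterBasisOfComm
    (finiteSums '' {E | ∀ i, E i ∈ F ∧ ∀ x ∈ E i, -x ∈ E i})
    ⟨_, fun _ => univ, fun _ => ⟨univ_mem, fun _ _ => trivial⟩, rfl⟩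
    (by
      rintro _ _ ⟨E, hE, rfl⟩ ⟨E', hE', rfl⟩
      exact ⟨_, ⟨fun i => E i ∩ E' i, fun i => ⟨inter_mem (hE i).1 (hE' i).1,
        fun x hx => ⟨(hE i).2 x hx.1, (hE' i).2 x hx.2⟩⟩, rfl⟩,
        subset_inter (finiteSums_mono fun _ => inter_subset_left)
          (finiteSums_mono fun _ => inter_subset_right)⟩)
    (by
      rintro _ ⟨E, -, rfl⟩
      exact mem_finiteSums.2 ⟨∅, 0, by simp⟩)
    (by
      rintro _ ⟨E, hE, rfl⟩
      refine ⟨_, ⟨fun i => E (2 * i) ∩ E (2 * i + 1), fun i =>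
        ⟨inter_mem (hE _).1 (hE _).1, fun x hx => ⟨(hE _).2 x hx.1, (hE _).2 x hx.2⟩⟩, rfl⟩, ?_⟩
      exact (add_subset_add (finiteSums_mono fun _ => inter_subset_left)
        (finiteSums_mono fun _ => inter_subset_right)).trans (finiteSums_add_finiteSums_subset E))
    (by
      rintro _ ⟨E, hE, rfl⟩
      refine ⟨_, ⟨E, hE, rfl⟩, fun x hx => ?_⟩
      obtain ⟨I, z, hz, rfl⟩ := mem_finiteSums.1 hx
      exact mem_finiteSums.2 ⟨I, -z, fun i hi => (hE i).2 _ (hz i hi), Finset.sum_neg_distrib ..⟩)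

theorem finiteSums_mem_nhdsZero_strongestTopology {F : Filter G} {E : ℕ → Set G}
    (hE : ∀ i, E i ∈ F) (hneg : ∀ i, ∀ x ∈ E i, -x ∈ E i) :
    finiteSums E ∈ nhdsZero (strongestTopology F) := by
  let B := finiteSumsFilterBasis F
  let τ : AddGroupTopology G := ⟨B.topology, B.isTopologicalAddGroup⟩
  have hF : F ≤ nhdsZero τ := by
    refine B.nhds_zero_hasBasis.ge_iff.2 ?_
    rintro _ ⟨E', hE', rfl⟩
    refine mem_of_superset (hE' 0).1 fun x hx => ?_
    exact mem_finiteSums.2 ⟨{0}, fun _ => x, by simpa using hx, by simp⟩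
  exact nhds_mono (strongestTopology_le hF)
    (B.mem_nhds_zero ⟨E, fun i => ⟨hE i, hneg i⟩, rfl⟩)

theorem addSubgroup_mem_nhdsZero_strongestTopology {F : Filter G} {H : AddSubgroup G}
    (hH : (H : Set G) ∈ F) : (H : Set G) ∈ nhdsZero (strongestTopology F) :=
  mem_of_superset
    (finiteSums_mem_nhdsZero_strongestTopology (fun _ => hH) fun _ _ => H.neg_mem)
    (finiteSums_subset_addSubmonoid (H := H.toAddSubmonoid) fun _ => subset_rfl)

end FiniteSums

section KOmega

theorem exists_forall_sum_range {M β : Type*} [AddCommMonoid M] (f : ℕ → β → M)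
    {P : ℕ → M → Prop} (h0 : P 0 0) (hstep : ∀ k x, P k x → ∃ b, P (k + 1) (x + f k b)) :
    ∃ g : ℕ → β, ∀ k, P k (∑ i ∈ Finset.range k, f i (g i)) := by
  choose b hb using hstep
  let x : ∀ k, {x // P k x} :=
    Nat.rec ⟨0, h0⟩ fun k x => ⟨x.1 + f k (b k x.1 x.2), hb k x.1 x.2⟩
  have hx : ∀ k, ∑ i ∈ Finset.range k, f i (b i (x i).1 (x i).2) = (x k).1 := by
    intro k
    induction k with
    | zero => rfl
    | succ k ih => rw [Finset.sum_range_succ, ih]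
  exact ⟨fun k => b k (x k).1 (x k).2, fun k => hx k ▸ (x k).2⟩

variable {G : Type*}

theorem finiteSums_subset_of_forall_sum_range_subset [AddCommMonoid G] {E : ℕ → Set G}
    {U : Set G} (h0 : ∀ i, 0 ∈ E i) (h : ∀ k, ∑ i ∈ Finset.range k, E i ⊆ U) :
    finiteSums E ⊆ U := by
  refine iUnion_subset fun I => Subset.trans ?_ (h (I.sup id + 1))
  exact Finset.sum_le_sum_of_subset_of_nonneg I.subset_range_sup_succ fun i _ _ =>
    singleton_subset_iff.2 (h0 i)

/-- The decreasing sequence `K` of compact sets containing zero converges to zero. -/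
structure ShrinksToZero [Zero G] [TopologicalSpace G] (K : ℕ → Set G) : Prop where
  isCompact : ∀ n, IsCompact (K n)
  zero_mem : ∀ n, 0 ∈ K n
  antitone : Antitone K
  tendsto : Tendsto K atTop (𝓝 0).smallSets

section AddCommMonoid

variable [AddCommMonoid G] [TopologicalSpace G] [ContinuousAdd G]

theorem isCompact_finsetSum {ι : Type*} {E : ι → Set G} (hE : ∀ i, IsCompact (E i))
    (I : Finset ι) : IsCompact (∑ i ∈ I, E i) :=
  Finset.sum_induction _ IsCompact (fun _ _ => IsCompact.add) isCompact_singleton fun i _ => hE i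

theorem exists_finiteSums_subset {K : ℕ → ℕ → Set G} (hK : ∀ i, ShrinksToZero (K i)) {U : Set G}
    (hU0 : 0 ∈ U) (hU : ∀ k, ∃ O, IsOpen O ∧
      (∑ i ∈ Finset.range k, K i 0) ∩ O = (∑ i ∈ Finset.range k, K i 0) ∩ U) :
    ∃ g : ℕ → ℕ, finiteSums (fun i => K i (g i)) ⊆ U := by
  let Q (k : ℕ) : Set G := ∑ i ∈ Finset.range k, K i 0
  have hstep (k : ℕ) (C : Set G) (hC : IsCompact C ∧ C ⊆ Q k ∩ U) :
      ∃ n, IsCompact (C + K k n) ∧ C + K k n ⊆ Q (k + 1) ∩ U := by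
    obtain ⟨hcC, hCQU⟩ := hC
    obtain ⟨O, hO, hOU⟩ := hU (k + 1)
    have hCK (n : ℕ) : C + K k n ⊆ Q (k + 1) := by
      rw [show Q (k + 1) = Q k + K k 0 from Finset.sum_range_succ ..]
      exact add_subset_add (hCQU.trans inter_subset_left) ((hK k).antitone n.zero_le)
    have hCO : C ⊆ O := fun x hx =>
      have hxQ : x ∈ Q (k + 1) := hCK 0 ⟨x, hx, 0, (hK k).zero_mem 0, add_zero x⟩
      (hOU.ge ⟨hxQ, (hCQU hx).2⟩).2
    obtain ⟨V, hV, hCV⟩ := compact_open_separated_add_right hcC hO hCO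
    obtain ⟨n, hn⟩ := (tendsto_smallSets_iff.1 (hK k).tendsto V hV).exists
    refine ⟨n, hcC.add ((hK k).isCompact n), fun x hx => hOU.le ⟨hCK n hx, ?_⟩⟩
    exact hCV (add_subset_add_left hn hx)
  obtain ⟨g, hg⟩ := exists_forall_sum_range K (P := fun k C => IsCompact C ∧ C ⊆ Q k ∩ U)
    ⟨isCompact_singleton, singleton_subset_iff.2 ⟨mem_singleton 0, hU0⟩⟩ hstep
  exact ⟨g, finiteSums_subset_of_forall_sum_range_subset (fun i => (hK i).zero_mem _) fun k =>
    (hg k).2.trans inter_subset_right⟩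

end AddCommMonoid

variable [AddCommGroup G]

theorem isCoherentWith_range_vadd_sum [TopologicalSpace G] [IsTopologicalAddGroup G]
    {K : ℕ → ℕ → Set G} (hK : ∀ i, ShrinksToZero (K i))
    (hnhds : ∀ g : ℕ → ℕ, finiteSums (fun i => K i (g i)) ∈ 𝓝 0) :
    IsCoherentWith (range fun p : G × ℕ => p.1 +ᵥ ∑ i ∈ Finset.range p.2, K i 0) := by
  refine ⟨fun U hU => isOpen_iff_mem_nhds.2 fun z hz => ?_⟩
  obtain ⟨g, hg⟩ := exists_finiteSums_subset hK (U := -z +ᵥ U)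
    (by simpa [mem_neg_vadd_set_iff] using hz) fun k => by
      obtain ⟨O, hO, hOU⟩ := isOpen_induced_iff.1 (hU _ ⟨(z, k), rfl⟩)
      refine ⟨-z +ᵥ O, hO.vadd _, ?_⟩
      rw [Subtype.preimage_val_eq_preimage_val_iff] at hOU
      simpa only [vadd_set_inter, neg_vadd_vadd] using congrArg (-z +ᵥ ·) hOU
  simpa using vadd_mem_nhds_vadd z (mem_of_superset (hnhds g) hg)

theorem isKOmegaGroup_of_finiteSums_mem_nhdsZero [Countable G] {τ : AddGroupTopology G}
    (hT2 : @T2Space G τ.toTopologicalSpace) {K : ℕ → ℕ → Set G}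
    (hK : ∀ i, @ShrinksToZero G _ τ.toTopologicalSpace (K i))
    (hnhds : ∀ g : ℕ → ℕ, finiteSums (fun i => K i (g i)) ∈ nhdsZero τ) : IsKOmegaGroup τ := by
  let := τ.toTopologicalSpace
  have := τ.toIsTopologicalAddGroup
  refine ⟨hT2, _, countable_range _, ?_, ?_, fun U =>
    (isCoherentWith_range_vadd_sum hK hnhds).isOpen_iff⟩
  · rintro _ ⟨p, rfl⟩
    exact (isCompact_finsetSum (fun i => (hK i).isCompact 0) _).vadd _
  · exact eq_univ_of_forall fun x => ⟨_, ⟨(x, 0), rfl⟩, 0, rfl, add_zero x⟩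

end KOmega

section RowTails

variable {G : Type*} [Zero G]

/-- Zero and the entries of the double sequence `a` in rows at most `i` and columns at least `n`;
compactness requires zero, the limit of every row. -/
def rowTails (a : ℕ × ℕ → G) (i n : ℕ) : Set G :=
  insert 0 (a '' Iic i ×ˢ Ici n)

theorem shrinksToZero_rowTails [TopologicalSpace G] {a : ℕ × ℕ → G}
    (ha : ∀ m, Tendsto (fun n => a (m, n)) atTop (𝓝 0)) (i : ℕ) :
    ShrinksToZero (rowTails a i) where
  isCompact n := by
    have hrows : rowTails a i n = ⋃ m ∈ Iic i, insert 0 (range fun k => a (m, k + n)) := by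
      ext x
      simp only [rowTails, mem_insert_iff, mem_image, mem_prod, Prod.exists, mem_Iic, mem_Ici,
        mem_iUnion, mem_range, exists_prop]
      constructor
      · rintro (rfl | ⟨m, n', ⟨hm, hn⟩, rfl⟩)
        · exact ⟨i, le_rfl, Or.inl rfl⟩
        · exact ⟨m, hm, Or.inr ⟨n' - n, by rw [Nat.sub_add_cancel hn]⟩⟩
      · rintro ⟨m, hm, rfl | ⟨k, rfl⟩⟩
        · exact Or.inl rfl
        · exact Or.inr ⟨m, k + n, ⟨hm, Nat.le_add_left n k⟩, rfl⟩
    rw [hrows]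
    exact (finite_Iic i).isCompact_biUnion fun m _ =>
      ((tendsto_add_atTop_iff_nat n).2 (ha m)).isCompact_insert_range
  zero_mem n := mem_insert 0 _
  antitone n n' h := insert_subset_insert (image_mono (prod_mono_right (Ici_subset_Ici.2 h)))
  tendsto := by
    refine tendsto_smallSets_iff.2 fun V hV => ?_
    have hrows : ∀ᶠ n in atTop, ∀ m ∈ Iic i, ∀ n' ≥ n, a (m, n') ∈ V :=
      (eventually_all_finite (finite_Iic i)).2 fun m _ =>
        eventually_forall_ge_atTop.2 ((ha m).eventually_mem hV)
    filter_upwards [hrows] with n hn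
    refine insert_subset (mem_of_mem_nhds hV) ?_
    rintro _ ⟨⟨m, n'⟩, ⟨hm, hn'⟩, rfl⟩
    exact hn m hm n' hn'

end RowTails

section Finsupp

variable {ι M : Type*} [AddCommGroup M]

theorem t2Space_strongestTopology_finsupp {F : Filter (ι →₀ M)}
    (hF : ∀ j, ∀ᶠ x in F, x j = 0) : @T2Space _ (strongestTopology F).toTopologicalSpace := by
  let := (strongestTopology F).toTopologicalSpace
  have := (strongestTopology F).toIsTopologicalAddGroup
  refine IsTopologicalAddGroup.t2Space_of_zero_sep fun x hx => ?_
  obtain ⟨j, hj⟩ := Finsupp.ne_iff.1 hx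
  exact ⟨_, addSubgroup_mem_nhdsZero_strongestTopology
    (H := (Finsupp.applyAddHom (M := M) j).ker) (hF j), hj⟩

theorem exists_injOn_support_of_mem_finiteSums {R : Type*} [Semiring R] [Nontrivial R]
    {A : ℕ → Set ι} {x : ι →₀ R} (hx : x ∈ finiteSums fun i => (Finsupp.single · 1) '' A i) :
    ∃ φ : ι → ℕ, InjOn φ x.support ∧ ∀ j ∈ x.support, j ∈ A (φ j) := by
  obtain ⟨I, z, hz, rfl⟩ := mem_finiteSums.1 hx
  have hterm : ∀ j ∈ (∑ i ∈ I, z i).support, ∃ i, j ∈ A i ∧ z i = Finsupp.single j 1 := by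
    intro j hj
    rw [Finsupp.mem_support_iff, Finsupp.finsetSum_apply] at hj
    obtain ⟨i, hi, hij⟩ := Finset.exists_ne_zero_of_sum_ne_zero hj
    obtain ⟨j', hj', hzi⟩ := hz i hi
    obtain rfl : j' = j := by
      by_contra hne
      exact hij (by simp only [← hzi, Finsupp.single_eq_of_ne' hne])
    exact ⟨i, hj', hzi.symm⟩
  choose! φ hφ hz' using hterm
  refine ⟨φ, fun j hj j' hj' h => ?_, hφ⟩
  exact Finsupp.single_left_injective one_ne_zero ((hz' j hj).symm.trans (h ▸ hz' j' hj'))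

end Finsupp

theorem exists_sum_eq_of_mem_span_zmod_two {ι V : Type*} [AddCommGroup V] [Module (ZMod 2) V]
    {v : ι → V} {x : V} (hx : x ∈ Submodule.span (ZMod 2) (range v)) :
    ∃ S : Finset ι, ∑ s ∈ S, v s = x := by
  obtain ⟨c, rfl⟩ := Finsupp.mem_span_range_iff_exists_finsupp.1 hx
  refine ⟨c.support, Finset.sum_congr rfl fun s hs => ?_⟩
  have hcs : c s = 1 := Fin.eq_one_of_ne_zero (c s) (Finsupp.mem_support_iff.1 hs)
  simp only [hcs, one_smul]

theorem exists_le_apply_of_injective {m : ℕ} {f : Fin (m + 1) → ℕ} (hf : Function.Injective f) :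
    ∃ l, m ≤ f l := by
  by_contra! h
  have := Finset.card_le_card_of_injOn (s := Finset.univ) (t := Finset.range m) f
    (fun l _ => Finset.mem_coe.2 (Finset.mem_range.2 (h l))) hf.injOn
  simp at this

/-- The indices of the basis of the Boolean group in the example: an index is a block, given by its
row and its column, together with a position in it; the blocks in row `m` have `m + 1` positions. -/
abbrev BlockIndex : Type := Σ s : ℕ × ℕ, Fin (s.1 + 1)

/-- The Boolean group with a basis indexed by `BlockIndex`. -/
abbrev BlockGroup : Type := BlockIndex →₀ ZMod 2

namespace BlockGroup

/-- The strongest group topology in which the basis converges to zero. -/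
noncomputable def basisTopology : AddGroupTopology BlockGroup :=
  strongestTopology (map (Finsupp.single · 1) cofinite)

/-- The sum of the basis elements in the block `s`. -/
noncomputable def blockSum (s : ℕ × ℕ) : BlockGroup :=
  ∑ l, Finsupp.single ⟨s, l⟩ 1

/-- The strongest group topology in which the sums of the blocks converge to zero. -/
noncomputable def blockTopology : AddGroupTopology BlockGroup :=
  strongestTopology (map blockSum cofinite)

theorem tendsto_fst_cofinite : Tendsto (Sigma.fst : BlockIndex → ℕ × ℕ) cofinite cofinite :=
  Tendsto.cofinite_of_finite_preimage_singleton fun s =>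
    (range_sigmaMk (α := fun s : ℕ × ℕ => Fin (s.1 + 1)) s) ▸ finite_range _

instance : Infinite BlockIndex :=
  Infinite.of_surjective Sigma.fst fun s : ℕ × ℕ => ⟨⟨s, 0⟩, rfl⟩

theorem blockSum_apply (s : ℕ × ℕ) (j : BlockIndex) :
    blockSum s j = if s = j.1 then 1 else 0 := by
  obtain ⟨t, l⟩ := j
  by_cases h : s = t
  · subst h
    simp [blockSum, Finsupp.single_apply]
  · simp [blockSum, h]

theorem t2Space_basisTopology : @T2Space BlockGroup basisTopology.toTopologicalSpace := by
  refine t2Space_strongestTopology_finsupp fun j => eventually_map.2 ?_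
  filter_upwards [(finite_singleton j).compl_mem_cofinite] with i hi
  exact Finsupp.single_eq_of_ne' hi

theorem isDeterminedByTSequence_basisTopology : IsDeterminedByTSequence basisTopology :=
  isDeterminedByTSequence_strongestTopology t2Space_basisTopology
    (Frequently.of_forall fun _ => Finsupp.single_ne_zero.2 one_ne_zero)

theorem isDeterminedByTSequence_blockTopology : IsDeterminedByTSequence blockTopology := by
  refine isDeterminedByTSequence_strongestTopology
    (t2Space_strongestTopology_finsupp fun j => eventually_map.2 ?_)
    (Frequently.of_forall fun s hs => ?_)
  · filter_upwards [(finite_singleton j.1).compl_mem_cofinite] with s hs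
    exact (blockSum_apply s j).trans (if_neg hs)
  · simpa [blockSum_apply] using DFunLike.congr_fun hs ⟨s, 0⟩

theorem tendsto_blockSum_row (m : ℕ) : Tendsto (fun n => blockSum (m, n)) atTop
    (nhdsZero (joinTopology basisTopology blockTopology)) := by
  have hrow : Tendsto (fun n : ℕ => (m, n)) atTop cofinite :=
    Nat.cofinite_eq_atTop ▸ (Prod.mk_right_injective m).tendsto_cofinite
  rw [nhdsZero_joinTopology, tendsto_inf]
  refine ⟨?_, (le_nhdsZero_strongestTopology (map blockSum cofinite)).trans' (map_mono hrow)⟩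
  let := basisTopology.toTopologicalSpace
  have := basisTopology.toIsTopologicalAddGroup
  have hterm (l : Fin (m + 1)) :
      Tendsto (fun n => Finsupp.single (⟨(m, n), l⟩ : BlockIndex) (1 : ZMod 2)) atTop (𝓝 0) := by
    have hbasis : Tendsto (fun j : BlockIndex => Finsupp.single j (1 : ZMod 2)) cofinite (𝓝 0) :=
      le_nhdsZero_strongestTopology _
    rw [← Nat.cofinite_eq_atTop]
    refine hbasis.comp (Function.Injective.tendsto_cofinite
      (f := fun n : ℕ => (⟨(m, n), l⟩ : BlockIndex)) fun n n' h => ?_)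
    exact congrArg (·.1.2) h
  simpa [blockSum] using tendsto_finsetSum Finset.univ fun l _ => hterm l

theorem sum_blockSum_apply (S : Finset (ℕ × ℕ)) (j : BlockIndex) :
    (∑ s ∈ S, blockSum s) j = if j.1 ∈ S then 1 else 0 := by
  simp only [Finsupp.finsetSum_apply, blockSum_apply, Finset.sum_ite_eq']

theorem blockSum_mem_supported {s : ℕ × ℕ} {T : Set (ℕ × ℕ)} :
    blockSum s ∈ Finsupp.supported (ZMod 2) (ZMod 2) (Sigma.fst ⁻¹' T : Set BlockIndex) ↔
      s ∈ T := by
  constructor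
  · intro h
    by_contra hs
    have h0 : blockSum s ⟨s, 0⟩ = 0 := (Finsupp.mem_supported' _ _).1 h _ hs
    simp [blockSum_apply] at h0
  · intro hs
    refine (Finsupp.mem_supported' _ _).2 fun j hj => ?_
    exact (blockSum_apply s j).trans (if_neg (ne_of_mem_of_not_mem hs hj))

/-- Every block of the support of `x` contains a position whose number is at least the row: there
are more positions than smaller numbers. These numbers are used for the blocks. -/
theorem mem_finiteSums_rowTails_blockSum {x : BlockGroup} {g : ℕ → ℕ}
    (hx : x ∈ Submodule.span (ZMod 2) (range blockSum))
    (hxg : x ∈ finiteSums fun i =>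
      (Finsupp.single · 1) '' {j : BlockIndex | j.1.1 ≤ i → g i ≤ j.1.2}) :
    x ∈ finiteSums fun i => rowTails blockSum i (g i) := by
  obtain ⟨S, rfl⟩ := exists_sum_eq_of_mem_span_zmod_two hx
  obtain ⟨φ, hφ, hφg⟩ := exists_injOn_support_of_mem_finiteSums hxg
  have hsupp {s : ℕ × ℕ} (hs : s ∈ S) (l : Fin (s.1 + 1)) :
      (⟨s, l⟩ : BlockIndex) ∈ (∑ s ∈ S, blockSum s).support := by
    simp [sum_blockSum_apply, hs]
  have hlarge : ∀ s : ℕ × ℕ, ∃ l : Fin (s.1 + 1), s ∈ S → s.1 ≤ φ ⟨s, l⟩ := by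
    intro s
    by_cases hs : s ∈ S
    · obtain ⟨l, hl⟩ := exists_le_apply_of_injective (f := fun l => φ ⟨s, l⟩) fun l l' h =>
        sigma_mk_injective (β := fun s : ℕ × ℕ => Fin (s.1 + 1)) (hφ (hsupp hs l) (hsupp hs l') h)
      exact ⟨l, fun _ => hl⟩
    · exact ⟨0, fun h => absurd h hs⟩
  choose L hL using hlarge
  refine sum_mem_finiteSums (ψ := fun s => φ ⟨s, L s⟩) (fun s hs t ht h => ?_) fun s hs => ?_
  · exact congrArg Sigma.fst (hφ (hsupp hs _) (hsupp ht _) h)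
  · exact mem_insert_of_mem _ ⟨s, ⟨hL s hs, hφg _ (hsupp hs _) (hL s hs)⟩, rfl⟩

theorem finiteSums_rowTails_blockSum_mem_nhdsZero (g : ℕ → ℕ) :
    (finiteSums fun i => rowTails blockSum i (g i)) ∈
      nhdsZero (joinTopology basisTopology blockTopology) := by
  have hspan : (Submodule.span (ZMod 2) (range blockSum) : Set BlockGroup) ∈
      nhdsZero blockTopology :=
    addSubgroup_mem_nhdsZero_strongestTopology
      (H := (Submodule.span (ZMod 2) (range blockSum)).toAddSubgroup)
      (eventually_map.2 (Eventually.of_forall fun s => Submodule.subset_span (mem_range_self s)))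
  have hcofinite (i : ℕ) : {j : BlockIndex | j.1.1 ≤ i → g i ≤ j.1.2} ∈ cofinite := by
    filter_upwards [tendsto_fst_cofinite
      ((finite_Iic i).prod (finite_Iio (g i))).compl_mem_cofinite] with j hj hji
    exact not_lt.1 fun hlt => hj ⟨hji, hlt⟩
  have hbasis : (finiteSums fun i =>
      (Finsupp.single · 1) '' {j : BlockIndex | j.1.1 ≤ i → g i ≤ j.1.2}) ∈
        nhdsZero basisTopology :=
    finiteSums_mem_nhdsZero_strongestTopology (fun i => image_mem_map (hcofinite i))
      fun i x hx => by rwa [ZModModule.neg_eq_self]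
  rw [nhdsZero_joinTopology]
  filter_upwards [mem_inf_of_left hbasis, mem_inf_of_right hspan] with x hxg hx
  exact mem_finiteSums_rowTails_blockSum hx hxg

theorem isKOmegaGroup_joinTopology :
    IsKOmegaGroup (joinTopology basisTopology blockTopology) := by
  have hT2 : @T2Space _ (joinTopology basisTopology blockTopology).toTopologicalSpace :=
    t2Space_antitone inf_le_left t2Space_basisTopology
  exact isKOmegaGroup_of_finiteSums_mem_nhdsZero hT2
    (@shrinksToZero_rowTails _ _ (joinTopology basisTopology blockTopology).toTopologicalSpace _
      tendsto_blockSum_row) finiteSums_rowTails_blockSum_mem_nhdsZero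

theorem supported_mem_nhdsZero_joinTopology (g : ℕ → ℕ) :
    (Finsupp.supported (ZMod 2) (ZMod 2) {j : BlockIndex | g j.1.1 ≤ j.1.2} : Set BlockGroup) ∈
      nhdsZero (joinTopology basisTopology blockTopology) := by
  refine mem_of_superset (finiteSums_rowTails_blockSum_mem_nhdsZero
    fun i => (Finset.range (i + 1)).sup g) ?_
  refine finiteSums_subset_addSubmonoid (H := (Finsupp.supported (ZMod 2) (ZMod 2)
    {j : BlockIndex | g j.1.1 ≤ j.1.2}).toAddSubmonoid) fun i => ?_
  refine insert_subset (zero_mem _) ?_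
  rintro _ ⟨s, ⟨hs, hgs⟩, rfl⟩
  refine blockSum_mem_supported (T := {s | g s.1 ≤ s.2}).2 ?_
  exact (Finset.le_sup (f := g) (Finset.mem_range_succ_iff.2 hs)).trans hgs

theorem exists_eventually_mem_supported_of_tendsto {b : ℕ → BlockGroup}
    (hb : ConvergesToZero (joinTopology basisTopology blockTopology) b) :
    ∃ m, ∀ᶠ n in atTop,
      b n ∈ Finsupp.supported (ZMod 2) (ZMod 2) {j : BlockIndex | j.1.1 ≤ m} := by
  by_contra! hb'
  have hfar (m : ℕ) : ∃ n ≥ m, ∃ j ∈ (b n).support, m < j.1.1 := by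
    obtain ⟨n, hn, hbn⟩ := frequently_atTop.1 (hb' m) m
    obtain ⟨j, hj, hjm⟩ := not_subset.1 hbn
    exact ⟨n, hn, j, hj, not_le.1 hjm⟩
  choose n hn j hj hrow using hfar
  let g (i : ℕ) : ℕ := (Finset.range i).sup fun m => (j m).1.2 + 1
  obtain ⟨N, hN⟩ := eventually_atTop.1 (hb.eventually_mem (supported_mem_nhdsZero_joinTopology g))
  have hcol : g (j N).1.1 ≤ (j N).1.2 := hN (n N) (hn N) (hj N)
  have hlt : (j N).1.2 + 1 ≤ g (j N).1.1 :=
    Finset.le_sup (f := fun m => (j m).1.2 + 1) (Finset.mem_range.2 (hrow N))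
  omega

theorem not_isDeterminedByTSequence_joinTopology :
    ¬ IsDeterminedByTSequence (joinTopology basisTopology blockTopology) := by
  rintro ⟨b, -, hb⟩
  obtain ⟨m, hm⟩ := exists_eventually_mem_supported_of_tendsto hb.1
  have hopen : (Finsupp.supported (ZMod 2) (ZMod 2) {j : BlockIndex | j.1.1 ≤ m} :
      Set BlockGroup) ∈ nhdsZero (joinTopology basisTopology blockTopology) :=
    isStrongestTopologyFor_iff.1 hb ▸ addSubgroup_mem_nhdsZero_strongestTopology
      (H := (Finsupp.supported (ZMod 2) (ZMod 2) {j : BlockIndex | j.1.1 ≤ m}).toAddSubgroup) hm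
  obtain ⟨n, hn⟩ := ((tendsto_blockSum_row (m + 1)).eventually_mem hopen).exists
  exact m.not_succ_le_self (blockSum_mem_supported (T := {s | s.1 ≤ m}).1 hn)

end BlockGroup

theorem corollary1 :
    ∃ (G : Type) (_ : AddCommGroup G) (τ₁ τ₂ : AddGroupTopology G),
      Countable G ∧
      IsDeterminedByTSequence τ₁ ∧ IsDeterminedByTSequence τ₂ ∧
      IsKOmegaGroup (joinTopology τ₁ τ₂) ∧
      ¬ IsDeterminedByTSequence (joinTopology τ₁ τ₂) :=
  ⟨BlockGroup, inferInstance, BlockGroup.basisTopology, BlockGroup.blockTopology, inferInstance,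
    BlockGroup.isDeterminedByTSequence_basisTopology,
    BlockGroup.isDeterminedByTSequence_blockTopology,
    BlockGroup.isKOmegaGroup_joinTopology, BlockGroup.not_isDeterminedByTSequence_joinTopology⟩
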